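/- **Lemma 6.4.** A *domain* is a non-empty open connected subset of $\mathbb{C}$. An *unbounded Jordan domain* is a domain $U\subset\mathbb{C}$ whose boundary in the Riemann sphere $\mathbb{C}\cup\{\infty\}$ is a Jordan curve passing through $\infty$. The class $\mathcal{B}_{\log}$ consists of the functions $F:\mathcal{T}\to H$, where $\mathcal{T},H\subset\mathbb{C}$, with the following properties. - $H$ is an unbounded Jordan domain that is $2\pi i$-periodic (invariant under translation by $2\pi i$ and by $-2\pi i$) and contains a right half-plane $\{z:\operatorname{Re}z>R\}$ for some $R\in\mathbb{R}$. - $\mathcal{T}$ is non-empty and $2\pi i$-periodic, and $\operatorname{Re}z$ is bounded from below but unbounded from above on $\mathcal{T}$. - Each connected component $T$ of $\mathcal{T}$ (called a *tract*) is an unbounded Jordan domain disjoint from all its translates $T+2\pi i k$, $k\in\mathbb{Z}\setminus\{0\}$, and $F|_T:T\to H$ is a conformal isomorphism. - $F$ extends continuously to the closure $\overline{\mathcal{T}}$ of $\mathcal{T}$ in $\mathbb{C}$ (the extension is again denoted by $F:\overline{\mathcal T}\to\mathbb{C}$) and, for each tract $T$, $F(z)\to\infty$ as $z\to\infty$ with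 $z\in\overline{T}$. - The tracts accumulate only at infinity: if $(z_n)$ is a sequence of points of $\mathcal{T}$ belonging to pairwise different tracts, then $z_n\to\infty$. Such an $F$ is of *disjoint type* if $\overline{\mathcal{T}}\subset H$. Its *Julia set* is $$J(F)=\{z\in\mathbb{C}: F^n(z)\in\overline{\mathcal{T}}\text{ for all }n\ge 0\}$$ (in particular all iterates of $z$ are defined). For a sequence $\underline{s}=s_0s_1s_2\ldots$ of tracts (an *external address*) let $$J_{\underline{s}}(F)=\{z\in J(F): F^n(z)\in\overline{s_n}\text{ for all }n\ge 0\},$$ and call $\underline{s}$ *admissible* if $J_{\underline{s}}(F)\neq\emptyset$. Suppose that $F\in\mathcal{B}_{\log}$ is of disjoint type and that $\underline{s}$ is an admissible external address. Then there is at most one point $z\in J_{\underline{s}}(F)$ whose orbit $\{z,F(z),F^2(z),\ldots\}$ is bounded. -/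

import Mathlib

open Filter Topology

/-- The translation `z ↦ z + 2πik`. -/
noncomputable def shift (k : ℤ) (z : ℂ) : ℂ := z + 2 * (Real.pi : ℂ) * Complex.I * (k : ℂ)

/-- `A` is invariant under translation by `2πi` (and hence by all its integer multiples). -/
def IsTwoPiIPeriodic (A : Set ℂ) : Prop := ∀ z : ℂ, shift 1 z ∈ A ↔ z ∈ A

/-- An unbounded Jordan domain in the plane: a domain `U ⊆ ℂ` whose boundary in the Riemann sphere
`ℂ ∪ {∞}` is a Jordan curve (a continuous injective image of the circle) passing through `∞`. -/
def IsUnboundedJordanDomain (U : Set ℂ) : Prop :=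
  IsOpen U ∧ IsConnected U ∧
    ∃ γ : Circle → OnePoint ℂ, Continuous γ ∧ Function.Injective γ ∧
      OnePoint.infty ∈ Set.range γ ∧
      frontier ((fun z : ℂ => (z : OnePoint ℂ)) '' U) = Set.range γ

/-- The tracts, that is, the connected components of `𝒯`. -/
def tracts (𝒯 : Set ℂ) : Set (Set ℂ) := {T | ∃ z ∈ 𝒯, T = connectedComponentIn 𝒯 z}

/-- The class `B_log`: `F : 𝒯 → H`, continuously extended to the closure of `𝒯`.
The function is total in Lean; its values outside `closure 𝒯` are irrelevant. -/
structure IsBLog (F : ℂ → ℂ) (𝒯 H : Set ℂ) : Prop where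
  /-- `H` is a `2πi`-periodic unbounded Jordan domain containing a right half-plane. -/
  H_periodic : IsTwoPiIPeriodic H
  H_jordan : IsUnboundedJordanDomain H
  H_halfPlane : ∃ R : ℝ, {z : ℂ | R < z.re} ⊆ H
  /-- `𝒯` is non-empty and `2πi`-periodic, with real parts bounded below but not above. -/
  T_nonempty : 𝒯.Nonempty
  T_periodic : IsTwoPiIPeriodic 𝒯
  T_re_bddBelow : BddBelow (Complex.re '' 𝒯)
  T_re_not_bddAbove : ¬ BddAbove (Complex.re '' 𝒯)
  /-- Each tract is an unbounded Jordan domain disjoint from its nontrivial `2πi`-translates. -/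
  tract_jordan : ∀ T ∈ tracts 𝒯, IsUnboundedJordanDomain T
  tract_disjoint : ∀ T ∈ tracts 𝒯, ∀ k : ℤ, k ≠ 0 → Disjoint T (shift k '' T)
  /-- `F` maps each tract conformally (holomorphically and bijectively) onto `H`. -/
  holo : ∀ T ∈ tracts 𝒯, DifferentiableOn ℂ F T
  bij : ∀ T ∈ tracts 𝒯, Set.BijOn F T H
  /-- `F` is continuous up to the finite boundary of `𝒯`. -/
  continuousOn_closure : ContinuousOn F (closure 𝒯)
  /-- On the closure of each tract, `F` extends continuously to `∞` by `F(∞) = ∞`. -/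
  tendsto_infty : ∀ T ∈ tracts 𝒯,
    Tendsto F (cocompact ℂ ⊓ 𝓟 (closure T)) (cocompact ℂ)
  /-- The tracts accumulate only at `∞`. -/
  accumulate : ∀ (z : ℕ → ℂ) (T : ℕ → Set ℂ), Function.Injective T →
    (∀ n, T n ∈ tracts 𝒯) → (∀ n, z n ∈ T n) → Tendsto z atTop (cocompact ℂ)

/-- `F : 𝒯 → H` is of disjoint type. -/
def IsDisjointType (𝒯 H : Set ℂ) : Prop := closure 𝒯 ⊆ H

/-- The Julia set `J(F)`: all iterates stay in the closure of `𝒯`. -/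
def julia (F : ℂ → ℂ) (𝒯 : Set ℂ) : Set ℂ := {z | ∀ n : ℕ, F^[n] z ∈ closure 𝒯}

/-- `s = s₀ s₁ …` is an external address of `z`: `F^n(z)` lies in the closure of `s_n`. -/
def HasExternalAddress (F : ℂ → ℂ) {𝒯 : Set ℂ} (z : ℂ) (s : ℕ → tracts 𝒯) : Prop :=
  ∀ n : ℕ, F^[n] z ∈ closure (s n : Set ℂ)

/-- The set `J_s(F)` of points of the Julia set with external address `s`. -/
def juliaAddress (F : ℂ → ℂ) {𝒯 : Set ℂ} (s : ℕ → tracts 𝒯) : Set ℂ :=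
  {z ∈ julia F 𝒯 | HasExternalAddress F z s}

/-- `s` is admissible if `J_s(F)` is non-empty. -/
def IsAdmissible (F : ℂ → ℂ) {𝒯 : Set ℂ} (s : ℕ → tracts 𝒯) : Prop :=
  (juliaAddress F s).Nonempty

/-- The orbit `{z, F(z), F²(z), …}` is bounded. -/
def HasBoundedOrbit (F : ℂ → ℂ) (z : ℂ) : Prop :=
  Bornology.IsBounded (Set.range fun n : ℕ => F^[n] z)

/-! The inverse branch of `F` on a tract sends `H` into that tract, which stays a fixed distance
inside `H`. It therefore strictly decreases the pseudo-distance `caratheodory H`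
(`caratheodory_comp_lt`), which here replaces the hyperbolic metric. For two orbits with the same
address, the distance `D n` between their `n`-th points is thus nondecreasing; it is at most `2`, so
it converges.

No uniform contraction factor is needed. By boundedness, both orbits converge in `H` along an
ultrafilter, and by `finite_range_of_boundedOrbit` the tract is constantly some `T` along it. The
two limit points and their images under the branch into `T` are then equally far apart, so
strictness makes the limit points equal. Hence `D` tends to `0`, and `D 0 = 0` gives equality of the
starting points by `caratheodory_pos`. -/

/-! ### The Carathéodory pseudo-distance -/

/-- Holomorphic functions on `U` bounded by `1`. -/
def unitHolo (U : Set ℂ) : Set (ℂ → ℂ) :=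
  {f | DifferentiableOn ℂ f U ∧ ∀ z ∈ U, ‖f z‖ ≤ 1}

/-- A variant of the Carathéodory pseudo-distance of `U`. -/
noncomputable def caratheodory (U : Set ℂ) (z w : ℂ) : ℝ :=
  sSup ((fun f : ℂ → ℂ => ‖f z - f w‖) '' unitHolo U)

theorem const_mem_unitHolo (U : Set ℂ) : (fun _ => (0 : ℂ)) ∈ unitHolo U :=
  ⟨differentiableOn_const _, by simp⟩

theorem norm_sub_le_two_of_mem_unitHolo {U : Set ℂ} {f : ℂ → ℂ} (hf : f ∈ unitHolo U) {z w : ℂ}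
    (hz : z ∈ U) (hw : w ∈ U) : ‖f z - f w‖ ≤ 2 := by
  have := norm_sub_le (f z) (f w)
  linarith [hf.2 z hz, hf.2 w hw]

theorem bddAbove_caratheodory {U : Set ℂ} {z w : ℂ} (hz : z ∈ U) (hw : w ∈ U) :
    BddAbove ((fun f : ℂ → ℂ => ‖f z - f w‖) '' unitHolo U) := by
  refine ⟨2, ?_⟩
  rintro _ ⟨f, hf, rfl⟩
  exact norm_sub_le_two_of_mem_unitHolo hf hz hw

theorem norm_sub_le_caratheodory {U : Set ℂ} {f : ℂ → ℂ} (hf : f ∈ unitHolo U) {z w : ℂ}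
    (hz : z ∈ U) (hw : w ∈ U) : ‖f z - f w‖ ≤ caratheodory U z w :=
  le_csSup (bddAbove_caratheodory hz hw) ⟨f, hf, rfl⟩

theorem caratheodory_le {U : Set ℂ} {z w : ℂ} {M : ℝ}
    (h : ∀ f ∈ unitHolo U, ‖f z - f w‖ ≤ M) : caratheodory U z w ≤ M := by
  refine csSup_le ⟨_, _, const_mem_unitHolo U, rfl⟩ ?_
  rintro _ ⟨f, hf, rfl⟩
  exact h f hf

theorem caratheodory_self {U : Set ℂ} {z : ℂ} (hz : z ∈ U) : caratheodory U z z = 0 :=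
  le_antisymm (caratheodory_le (by simp))
    ((norm_nonneg _).trans (norm_sub_le_caratheodory (const_mem_unitHolo U) hz hz))

/-- The Schwarz lemma; the constant does not depend on `f`, which gives equicontinuity. -/
theorem dist_le_of_mem_unitHolo {U : Set ℂ} {f : ℂ → ℂ} (hf : f ∈ unitHolo U) {z w : ℂ} {r : ℝ}
    (hr : Metric.ball z r ⊆ U) (hw : w ∈ Metric.ball z r) : ‖f w - f z‖ ≤ 2 / r * ‖w - z‖ := by
  have hz : z ∈ U := hr (Metric.mem_ball_self (Metric.pos_of_mem_ball hw))
  have := Complex.dist_le_div_mul_dist_of_mapsTo_ball (f := f) (c := z) (R₁ := r) (R₂ := 2)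
    (z := w) (hf.1.mono hr) (fun y hy => by
      rw [Metric.mem_closedBall, dist_eq_norm]
      exact norm_sub_le_two_of_mem_unitHolo hf (hr hy) hz) hw
  rwa [dist_eq_norm, dist_eq_norm] at this

/-- Montel's argument with an ultrafilter: pointwise limits of a maximizing sequence exist by
compactness of the disc, and the common Lipschitz bound makes convergence locally uniform. -/
theorem exists_extremal_caratheodory {U : Set ℂ} (hU : IsOpen U) {z w : ℂ} (hz : z ∈ U)
    (hw : w ∈ U) : ∃ f ∈ unitHolo U, ‖f z - f w‖ = caratheodory U z w := by
  obtain ⟨u, -, hu, hmem⟩ := exists_seq_tendsto_sSup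
    (S := (fun f : ℂ → ℂ => ‖f z - f w‖) '' unitHolo U) ⟨_, _, const_mem_unitHolo U, rfl⟩
    (bddAbove_caratheodory hz hw)
  choose f hf hfu using hmem
  set V : Ultrafilter ℕ := hyperfilter ℕ with hV
  have hVle : (V : Filter ℕ) ≤ atTop := by
    rw [← Nat.cofinite_eq_atTop]; exact hyperfilter_le_cofinite
  have hlim : ∀ x, ∃ y, x ∈ U → ‖y‖ ≤ 1 ∧ Tendsto (fun n => f n x) V (𝓝 y) := by
    intro x
    by_cases hx : x ∈ U
    · obtain ⟨y, hy, hle⟩ := (isCompact_closedBall (0 : ℂ) 1).ultrafilter_le_nhds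
        (V.map fun n => f n x) (by
          rw [le_principal_iff]
          exact mem_map.2 (univ_mem' fun n => by simpa using (hf n).2 x hx))
      exact ⟨y, fun _ => ⟨by simpa using hy, hle⟩⟩
    · exact ⟨0, fun h => (hx h).elim⟩
  choose g hg using hlim
  have hloc : TendstoLocallyUniformlyOn f g V U := by
    rw [Metric.tendstoLocallyUniformlyOn_iff]
    intro ε hε x hx
    obtain ⟨r, hr0, hr⟩ := Metric.isOpen_iff.1 hU x hx
    have hlip : ∀ y ∈ Metric.ball x r, ‖g y - g x‖ ≤ 2 / r * ‖y - x‖ := fun y hy =>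
      le_of_tendsto (f := fun n => ‖f n y - f n x‖) (((hg y (hr hy)).2.sub (hg x hx).2).norm)
        (Eventually.of_forall fun n => dist_le_of_mem_unitHolo (hf n) hr hy)
    have hev : ∀ᶠ y in 𝓝 x, 2 / r * ‖y - x‖ < ε / 3 := by
      have : Tendsto (fun y : ℂ => 2 / r * ‖y - x‖) (𝓝 x) (𝓝 (2 / r * ‖x - x‖)) :=
        Continuous.tendsto (by fun_prop) x
      exact this.eventually_lt_const (by simpa using by positivity)
    refine ⟨_, nhdsWithin_le_nhds (inter_mem hev (Metric.ball_mem_nhds x hr0)), ?_⟩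
    filter_upwards [Metric.tendsto_nhds.1 (hg x hx).2 (ε / 3) (by positivity)] with n hn y hy
    have h1 := hlip y hy.2
    have h2 := dist_le_of_mem_unitHolo (hf n) hr hy.2
    have h3 : 2 / r * ‖y - x‖ < ε / 3 := hy.1
    rw [← dist_eq_norm] at h1 h2
    calc dist (g y) (f n y) ≤ dist (g y) (g x) + dist (g x) (f n x) + dist (f n x) (f n y) :=
          dist_triangle4 _ _ _ _
      _ < ε := by rw [dist_comm (g x), dist_comm (f n x) (f n y)]; linarith
  refine ⟨g, ⟨hloc.differentiableOn (Eventually.of_forall fun n => (hf n).1) hU,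
    fun x hx => (hg x hx).1⟩, ?_⟩
  refine tendsto_nhds_unique ((hg z hz).2.sub (hg w hw).2).norm ?_
  simp only [hfu]
  exact hu.mono_left hVle

theorem caratheodory_tendsto {U : Set ℂ} (hU : IsOpen U) {ι : Type*} {l : Filter ι}
    {u v : ι → ℂ} {z w : ℂ} (hz : z ∈ U) (hw : w ∈ U) (hu : Tendsto u l (𝓝 z))
    (hv : Tendsto v l (𝓝 w)) :
    Tendsto (fun i => caratheodory U (u i) (v i)) l (𝓝 (caratheodory U z w)) := by
  obtain ⟨r, hr0, hr⟩ := Metric.isOpen_iff.1 hU z hz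
  obtain ⟨t, ht0, ht⟩ := Metric.isOpen_iff.1 hU w hw
  rw [tendsto_iff_dist_tendsto_zero]
  have hb : Tendsto (fun i => 2 / r * ‖u i - z‖ + 2 / t * ‖v i - w‖) l (𝓝 0) := by
    have := ((hu.sub_const z).norm.const_mul (2 / r)).add ((hv.sub_const w).norm.const_mul (2 / t))
    simpa using this
  refine squeeze_zero' (Eventually.of_forall fun _ => dist_nonneg) ?_ hb
  filter_upwards [hu (Metric.ball_mem_nhds z hr0), hv (Metric.ball_mem_nhds w ht0)] with i hi hj
  rw [Real.dist_eq, abs_sub_le_iff]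
  constructor
  · rw [sub_le_iff_le_add]
    refine caratheodory_le fun f hf => ?_
    have h1 := dist_le_of_mem_unitHolo hf hr hi
    have h2 := dist_le_of_mem_unitHolo hf ht hj
    have h3 := norm_sub_le_caratheodory hf hz hw
    have : f (u i) - f (v i) = (f (u i) - f z) + (f z - f w) - (f (v i) - f w) := by ring
    rw [this]
    refine (norm_sub_le _ _).trans ?_
    have := norm_add_le (f (u i) - f z) (f z - f w)
    linarith
  · rw [sub_le_iff_le_add]
    refine caratheodory_le fun f hf => ?_
    have h1 := dist_le_of_mem_unitHolo hf hr hi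
    have h2 := dist_le_of_mem_unitHolo hf ht hj
    have h3 := norm_sub_le_caratheodory hf (hr hi) (ht hj)
    have : f z - f w = (f (u i) - f (v i)) - (f (u i) - f z) + (f (v i) - f w) := by ring
    rw [this]
    refine (norm_add_le _ _).trans ?_
    have := norm_sub_le (f (u i) - f (v i)) (f (u i) - f z)
    linarith

theorem caratheodory_comp_le {U : Set ℂ} {G : ℂ → ℂ} (hG : DifferentiableOn ℂ G U)
    (hmaps : Set.MapsTo G U U) {z w : ℂ} (hz : z ∈ U) (hw : w ∈ U) :
    caratheodory U (G z) (G w) ≤ caratheodory U z w :=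
  caratheodory_le fun f hf => norm_sub_le_caratheodory (f := f ∘ G)
    ⟨hf.1.comp hG hmaps, fun _ hx => hf.2 _ (hmaps hx)⟩ hz hw

/-! ### Separation and strict contraction -/

/-- If `T` omits a disc, then an injective map `G : U → T` separates the Carathéodory distance. -/
theorem caratheodory_pos {U T : Set ℂ} {G : ℂ → ℂ} (hG : DifferentiableOn ℂ G U)
    (hmaps : Set.MapsTo G U T) (hinj : Set.InjOn G U) {a : ℂ} {r : ℝ} (hr : 0 < r)
    (ha : ∀ y ∈ T, r ≤ ‖y - a‖) {z w : ℂ} (hz : z ∈ U) (hw : w ∈ U) (hzw : z ≠ w) :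
    0 < caratheodory U z w := by
  have hne : ∀ y ∈ T, y - a ≠ 0 := fun y hy h => by
    have := ha y hy; rw [h, norm_zero] at this; linarith
  have hmem : (fun y => (r : ℂ) / (G y - a)) ∈ unitHolo U := by
    refine ⟨(differentiableOn_const _).div (hG.sub_const a) fun x hx => hne _ (hmaps hx), ?_⟩
    intro x hx
    have h1 := ha _ (hmaps hx)
    rw [norm_div, Complex.norm_real, Real.norm_of_nonneg hr.le]
    exact div_le_one_of_le₀ h1 (norm_nonneg _)
  refine lt_of_lt_of_le ?_ (norm_sub_le_caratheodory hmem hz hw)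
  rw [norm_pos_iff, sub_ne_zero]
  intro h
  have h1 := hne _ (hmaps hz)
  have h2 := hne _ (hmaps hw)
  have hr' : (r : ℂ) ≠ 0 := by exact_mod_cast hr.ne'
  rw [div_eq_div_iff h1 h2] at h
  have := mul_left_cancel₀ hr' h
  exact hzw (hinj hz hw (by linear_combination -this))

/-- Strict contraction: if `T` omits a disc and a whole neighbourhood of `T` of fixed width lies
in `U`, then holomorphic injective maps `U → T` strictly decrease the Carathéodory distance. -/
theorem caratheodory_comp_lt {U T : Set ℂ} (hU : IsOpen U) (hUc : IsPreconnected U)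
    {G : ℂ → ℂ} (hG : DifferentiableOn ℂ G U)
    (hmaps : Set.MapsTo G U T) (hinj : Set.InjOn G U) {a : ℂ} {r : ℝ} (hr : 0 < r)
    (ha : ∀ y ∈ T, r ≤ ‖y - a‖) {ε : ℝ} (hε : 0 < ε)
    (hT : ∀ y ∈ T, ∀ v : ℂ, ‖v‖ < ε → y + v ∈ U) {z w : ℂ} (hz : z ∈ U) (hw : w ∈ U)
    (hzw : z ≠ w) : caratheodory U (G z) (G w) < caratheodory U z w := by
  have hTU : T ⊆ U := fun y hy => by simpa using hT y hy 0 (by simpa using hε)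
  have hne : ∀ y ∈ T, y - a ≠ 0 := fun y hy h => by
    have := ha y hy; rw [h, norm_zero] at this; linarith
  have hGz := hmaps hz
  have hGw := hmaps hw
  have hGzw : G z ≠ G w := fun h => hzw (hinj hz hw h)
  have hpos : 0 < caratheodory U (G z) (G w) :=
    caratheodory_pos hG hmaps hinj hr ha (hTU hGz) (hTU hGw) hGzw
  refine lt_of_le_of_ne (caratheodory_comp_le hG (hmaps.mono_right hTU) hz hw) fun heq => ?_
  obtain ⟨f, hf, hfe⟩ := exists_extremal_caratheodory hU (hTU hGz) (hTU hGw)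
  -- Adding `δ * ψ` to `G` keeps the value at `w` but moves the value at `z` in every direction; the
  -- bound `2 / r` on `ψ` keeps the image in `U` for small `δ`.
  set ψ : ℂ → ℂ := fun y => 1 / (y - a) - 1 / (G w - a) with hψ
  have hψb : ∀ y ∈ T, ‖ψ y‖ ≤ 2 / r := by
    intro y hy
    have h1 : ∀ y ∈ T, ‖1 / (y - a)‖ ≤ 1 / r := fun y hy => by
      rw [norm_div, norm_one]; exact one_div_le_one_div_of_le hr (ha y hy)
    refine (norm_sub_le _ _).trans ?_
    have := h1 y hy
    have := h1 _ hGw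
    rw [show 2 / r = 1 / r + 1 / r by ring]
    linarith
  have hψd : DifferentiableOn ℂ ψ T := by
    refine DifferentiableOn.sub_const ?_ _
    exact (differentiableOn_const _).div (differentiableOn_id.sub_const a) hne
  have hψz : ψ (G z) ≠ 0 := by
    simp only [hψ, ne_eq, sub_eq_zero]
    rw [div_eq_div_iff (hne _ hGz) (hne _ hGw)]
    intro h
    exact hGzw (by linear_combination -h)
  have hψw : ψ (G w) = 0 := by simp [hψ]
  have hcomp : ∀ δ : ℂ, ‖δ‖ < ε * r / 2 →
      ‖f (G z + δ * ψ (G z)) - f (G w)‖ ≤ caratheodory U z w := by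
    intro δ hδ
    have hin : Set.MapsTo (fun x => G x + δ * ψ (G x)) U U := by
      intro x hx
      refine hT _ (hmaps hx) _ ?_
      rw [norm_mul]
      calc ‖δ‖ * ‖ψ (G x)‖ ≤ ‖δ‖ * (2 / r) := by gcongr; exact hψb _ (hmaps hx)
        _ < ε * r / 2 * (2 / r) := by gcongr
        _ = ε := by field_simp
    have hd : DifferentiableOn ℂ (fun x => G x + δ * ψ (G x)) U :=
      hG.add ((hψd.comp hG hmaps).const_mul δ)
    have := norm_sub_le_caratheodory (f := f ∘ fun x => G x + δ * ψ (G x))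
      ⟨hf.1.comp hd hin, fun x hx => hf.2 _ (hin hx)⟩ hz hw
    simpa [hψw] using this
  -- If equality held, the extremal `f` would violate the maximum principle at `G z` unless
  -- constant, contradicting `hpos`.
  have hmax : IsLocalMax (norm ∘ fun y => f y - f (G w)) (G z) := by
    have : ∀ᶠ y in 𝓝 (G z), ‖(y - G z) / ψ (G z)‖ < ε * r / 2 := by
      have : Tendsto (fun y : ℂ => ‖(y - G z) / ψ (G z)‖) (𝓝 (G z))
          (𝓝 ‖(G z - G z) / ψ (G z)‖) := Continuous.tendsto (by fun_prop) _
      exact this.eventually_lt_const (by simpa using by positivity)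
    filter_upwards [this] with y hy
    have := hcomp _ hy
    rw [div_mul_cancel₀ _ hψz, add_sub_cancel] at this
    rw [Function.comp_apply, Function.comp_apply, hfe, heq]
    exact this
  have hd : ∀ᶠ y in 𝓝 (G z), DifferentiableAt ℂ (fun y => f y - f (G w)) y := by
    filter_upwards [hU.mem_nhds (hTU hGz)] with y hy
    exact (hf.1.differentiableAt (hU.mem_nhds hy)).sub_const _
  have hev := Complex.eventually_eq_of_isLocalMax_norm hd hmax
  have hconst := (hf.1.analyticOnNhd hU).eqOn_of_preconnected_of_eventuallyEq
    (analyticOnNhd_const (v := f (G z))) hUc (hTU hGz) (hev.mono fun y hy => by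
      simpa using hy)
  have := hconst (hTU hGw)
  rw [← hfe, this, sub_self, norm_zero] at hpos
  exact lt_irrefl _ hpos

/-! ### Holomorphy of inverses -/

/-- The inverse of an injective holomorphic function is holomorphic. -/
theorem differentiableOn_of_rightInverse {F G : ℂ → ℂ} {T U : Set ℂ} (hT : IsOpen T)
    (hF : DifferentiableOn ℂ F T) (hinj : Set.InjOn F T) (hU : IsOpen U)
    (hmaps : Set.MapsTo G U T) (hFG : ∀ w ∈ U, F (G w) = w) : DifferentiableOn ℂ G U := by
  have hnc : ∀ z ∈ T, ¬ ∀ᶠ y in 𝓝 z, F y = F z := by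
    intro z hz h
    have h1 : ∀ᶠ y in 𝓝 z, y = z := by
      filter_upwards [h, hT.mem_nhds hz] with y hy hyT using hinj hyT hz hy
    have h2 : ∀ᶠ y in 𝓝[≠] z, y = z := h1.filter_mono nhdsWithin_le_nhds
    obtain ⟨y, hy, hne⟩ := (h2.and self_mem_nhdsWithin).exists
    exact hne hy
  have han := hF.analyticOnNhd hT
  have hcont : ∀ w ∈ U, ContinuousAt G w := by
    intro w hw
    rw [ContinuousAt, tendsto_def]
    intro s hs
    have hopen := (han _ (hmaps hw)).eventually_constant_or_nhds_le_map_nhds.resolve_left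
      (hnc _ (hmaps hw))
    rw [hFG w hw] at hopen
    have : F '' (s ∩ T) ∈ 𝓝 w :=
      hopen (image_mem_map (inter_mem hs (hT.mem_nhds (hmaps hw))))
    filter_upwards [this, hU.mem_nhds hw] with y hy hyU
    obtain ⟨x, ⟨hxs, hxT⟩, rfl⟩ := hy
    have : G (F x) = x := hinj (hmaps hyU) hxT (hFG _ hyU)
    rwa [Set.mem_preimage, this]
  have hder : ∀ w ∈ U, deriv F (G w) ≠ 0 → DifferentiableAt ℂ G w := by
    intro w hw h
    have h1 := (hF.differentiableAt (hT.mem_nhds (hmaps hw))).hasDerivAt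
    exact (h1.of_local_left_inverse (hcont w hw) h
      (by filter_upwards [hU.mem_nhds hw] with y hy using hFG y hy)).differentiableAt
  intro w hw
  refine AnalyticAt.differentiableWithinAt
    -- Critical points of `F` are isolated, so their images are removable singularities of the
    -- continuous map `G`.
    (Complex.analyticAt_of_differentiable_on_punctured_nhds_of_continuousAt ?_ (hcont w hw))
  have hd := (han _ (hmaps hw)).deriv
  rcases hd.eventually_eq_zero_or_eventually_ne_zero with h0 | h0
  · exfalso
    refine hnc _ (hmaps hw) ?_
    obtain ⟨ρ, hρ0, hρ⟩ := Metric.eventually_nhds_iff_ball.1 (h0.and (hT.mem_nhds (hmaps hw)))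
    filter_upwards [Metric.ball_mem_nhds _ hρ0] with y hy
    exact (convex_ball (G w) ρ).is_const_of_fderivWithin_eq_zero (𝕜 := ℂ)
      (hF.mono fun x hx => (hρ x hx).2) (fun x hx => by
        rw [fderivWithin_of_isOpen Metric.isOpen_ball hx]
        ext
        simpa using (hρ x hx).1) hy (Metric.mem_ball_self hρ0)
  · have hne : ∀ᶠ y in 𝓝[≠] w, G y ∈ ({G w}ᶜ : Set ℂ) := by
      filter_upwards [self_mem_nhdsWithin, nhdsWithin_le_nhds (hU.mem_nhds hw)] with y hy hyU h
      exact hy (by rw [Set.mem_singleton_iff, ← hFG y hyU, ← hFG w hw, h])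
    have ht : Tendsto G (𝓝[≠] w) (𝓝[≠] (G w)) :=
      tendsto_nhdsWithin_iff.2 ⟨(hcont w hw).mono_left nhdsWithin_le_nhds, hne⟩
    filter_upwards [ht.eventually h0, nhdsWithin_le_nhds (hU.mem_nhds hw)] with y hy hyU
    exact hder y hyU hy

/-! ### Periodicity and the geometry of tracts -/

theorem shift_periodic {A : Set ℂ} (hA : IsTwoPiIPeriodic A) (k : ℤ) (z : ℂ) :
    shift k z ∈ A ↔ z ∈ A := by
  have hsucc : ∀ (k : ℤ) (z : ℂ), shift (k + 1) z = shift 1 (shift k z) := by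
    intro k z; simp only [shift]; push_cast; ring
  induction k using Int.induction_on with
  | zero => simp [shift]
  | succ n ih =>
    rw [hsucc]
    exact (hA _).trans ih
  | pred n ih =>
    refine Iff.trans ?_ ih
    have := hA (shift (-(n : ℤ) - 1) z)
    rw [← hsucc, sub_add_cancel] at this
    exact this.symm

theorem exists_shift_im_mem (z : ℂ) :
    ∃ k : ℤ, (shift k z).re = z.re ∧ (shift k z).im ∈ Set.Ico 0 (2 * Real.pi) := by
  obtain ⟨k, hk, -⟩ := existsUnique_add_zsmul_mem_Ico Real.two_pi_pos z.im 0
  refine ⟨k, by simp [shift], ?_⟩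
  have : (shift k z).im = z.im + k • (2 * Real.pi) := by simp [shift, mul_comm]
  rwa [zero_add, ← this] at hk

/-- For functions of disjoint type, `𝒯` has positive distance to the complement of `H`. -/
theorem exists_uniform_nhd {F : ℂ → ℂ} {𝒯 H : Set ℂ} (hF : IsBLog F 𝒯 H)
    (hd : IsDisjointType 𝒯 H) :
    ∃ ε > 0, ∀ y ∈ 𝒯, ∀ v : ℂ, ‖v‖ < ε → y + v ∈ H := by
  obtain ⟨R, hR⟩ := hF.H_halfPlane
  obtain ⟨b, hb⟩ := hF.T_re_bddBelow
  -- Modulo `2πi`, only this compact piece matters: to the right of `R + 1`, a move by less than `1`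
  -- stays in the half-plane.
  set K : Set ℂ := closure 𝒯 ∩ (Set.Icc b (R + 1) ×ℂ Set.Icc 0 (2 * Real.pi)) with hK
  have hKc : IsCompact K := (isCompact_Icc.reProdIm isCompact_Icc).inter_left isClosed_closure
  obtain ⟨δ, hδ, hKδ⟩ := hKc.exists_thickening_subset_open hF.H_jordan.1
    (Set.inter_subset_left.trans hd)
  refine ⟨min δ 1, by positivity, fun y hy v hv => ?_⟩
  by_cases hyR : y.re ≤ R + 1
  · obtain ⟨k, hk1, hk2⟩ := exists_shift_im_mem y
    have hmem : shift k y ∈ K := by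
      refine ⟨subset_closure ((shift_periodic hF.T_periodic k y).2 hy), ?_⟩
      rw [Complex.mem_reProdIm, hk1]
      exact ⟨⟨hb ⟨y, hy, rfl⟩, hyR⟩, ⟨hk2.1, hk2.2.le⟩⟩
    have : shift k (y + v) ∈ H := by
      refine hKδ (Metric.mem_thickening_iff.2 ⟨_, hmem, ?_⟩)
      have : shift k (y + v) - shift k y = v := by simp only [shift]; ring
      rw [dist_eq_norm, this]
      exact hv.trans_le (min_le_left _ _)
    exact (shift_periodic hF.H_periodic k _).1 this
  · refine hR ?_
    have h1 := (Complex.abs_re_le_norm v).trans_lt (hv.trans_le (min_le_right _ _))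
    rw [Set.mem_ofPred_eq, Complex.add_re]
    linarith [(abs_lt.1 h1).1]

theorem tract_subset {𝒯 T : Set ℂ} (hT : T ∈ tracts 𝒯) : T ⊆ 𝒯 := by
  obtain ⟨z, -, rfl⟩ := hT
  exact connectedComponentIn_subset _ _

/-- A tract omits a disc, namely one contained in its translate by `2πi`. -/
theorem exists_omitted_disc {F : ℂ → ℂ} {𝒯 H T : Set ℂ} (hF : IsBLog F 𝒯 H)
    (hT : T ∈ tracts 𝒯) : ∃ a : ℂ, ∃ r > 0, ∀ y ∈ T, r ≤ ‖y - a‖ := by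
  obtain ⟨hTo, hTc, -⟩ := hF.tract_jordan T hT
  obtain ⟨t, ht⟩ := hTc.nonempty
  have hopen : IsOpen (shift 1 '' T) :=
    (Homeomorph.addRight (2 * (Real.pi : ℂ) * Complex.I * ((1 : ℤ) : ℂ))).isOpenMap T hTo
  obtain ⟨r, hr, hball⟩ := Metric.isOpen_iff.1 hopen _ ⟨t, ht, rfl⟩
  refine ⟨shift 1 t, r, hr, fun y hy => ?_⟩
  by_contra h
  refine Set.disjoint_left.1 (hF.tract_disjoint T hT 1 one_ne_zero) hy (hball ?_)
  rw [Metric.mem_ball, dist_eq_norm]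
  exact not_le.1 h

/-! ### Inverse branches -/

/-- The inverse branch of `F` with values in `T`. -/
noncomputable def inverseBranch (F : ℂ → ℂ) (T : Set ℂ) : ℂ → ℂ := Function.invFunOn F T

section inverseBranch

variable {F : ℂ → ℂ} {𝒯 H T : Set ℂ}

theorem inverseBranch_mapsTo (hF : IsBLog F 𝒯 H) (hT : T ∈ tracts 𝒯) :
    Set.MapsTo (inverseBranch F T) H T :=
  (hF.bij T hT).surjOn.mapsTo_invFunOn

theorem map_inverseBranch (hF : IsBLog F 𝒯 H) (hT : T ∈ tracts 𝒯) {w : ℂ} (hw : w ∈ H) :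
    F (inverseBranch F T w) = w :=
  (hF.bij T hT).surjOn.rightInvOn_invFunOn hw

theorem inverseBranch_injOn (hF : IsBLog F 𝒯 H) (hT : T ∈ tracts 𝒯) :
    Set.InjOn (inverseBranch F T) H := fun x hx y hy h => by
  rw [← map_inverseBranch hF hT hx, h, map_inverseBranch hF hT hy]

theorem inverseBranch_differentiableOn (hF : IsBLog F 𝒯 H) (hT : T ∈ tracts 𝒯) :
    DifferentiableOn ℂ (inverseBranch F T) H :=
  differentiableOn_of_rightInverse (hF.tract_jordan T hT).1 (hF.holo T hT) (hF.bij T hT).injOn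
    hF.H_jordan.1 (inverseBranch_mapsTo hF hT) fun _ hw => map_inverseBranch hF hT hw

/-- A point of the closure of a tract that `F` maps into `H` is given by the inverse branch. -/
theorem inverseBranch_map (hF : IsBLog F 𝒯 H) (hT : T ∈ tracts 𝒯) {z : ℂ} (hz : z ∈ closure T)
    (hFz : F z ∈ H) : inverseBranch F T (F z) = z := by
  have hne : (𝓝[T] z).NeBot := mem_closure_iff_nhdsWithin_neBot.1 hz
  have hFt : Tendsto F (𝓝[T] z) (𝓝 (F z)) :=
    (hF.continuousOn_closure z (closure_mono (tract_subset hT) hz)).mono_left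
      (nhdsWithin_mono _ ((tract_subset hT).trans subset_closure))
  have hG : ContinuousAt (inverseBranch F T) (F z) :=
    (inverseBranch_differentiableOn hF hT).continuousOn.continuousAt
      (hF.H_jordan.1.mem_nhds hFz)
  have h1 : Tendsto (fun y => inverseBranch F T (F y)) (𝓝[T] z)
      (𝓝 (inverseBranch F T (F z))) := hG.tendsto.comp hFt
  refine tendsto_nhds_unique h1 (Tendsto.congr' ?_ (tendsto_id.mono_left nhdsWithin_le_nhds))
  filter_upwards [self_mem_nhdsWithin] with y hy
  have hFy := (hF.bij T hT).mapsTo hy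
  exact ((hF.bij T hT).injOn (inverseBranch_mapsTo hF hT hFy) hy
    (map_inverseBranch hF hT hFy)).symm

end inverseBranch

/-! ### Bounded orbits and the conclusion -/

/-- A bounded orbit visits only finitely many tracts. -/
theorem finite_range_of_boundedOrbit {F : ℂ → ℂ} {𝒯 H : Set ℂ} (hF : IsBLog F 𝒯 H)
    {s : ℕ → tracts 𝒯} {z : ℂ} (hz : ∀ n, F^[n] z ∈ (s n : Set ℂ)) (hb : HasBoundedOrbit F z) :
    (Set.range s).Finite := by
  by_contra hinf
  have hinf : (Set.range s).Infinite := hinf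
  let e := hinf.natEmbedding
  choose k hk using fun n => (e n).2
  have ht := hF.accumulate (fun n => F^[k n] z) (fun n => ((e n : tracts 𝒯) : Set ℂ))
    (fun m n h => e.injective (Subtype.ext (Subtype.ext h))) (fun n => (e n : tracts 𝒯).2)
    (fun n => by rw [← hk n]; exact hz _)
  obtain ⟨n, hn⟩ := (ht.eventually hb.isCompact_closure.compl_mem_cocompact).exists
  exact hn (subset_closure ⟨k n, rfl⟩)

theorem lemma6p4 (F : ℂ → ℂ) (𝒯 H : Set ℂ) (hF : IsBLog F 𝒯 H) (hd : IsDisjointType 𝒯 H)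
    (s : ℕ → tracts 𝒯) (hs : IsAdmissible F s) :
    {z : ℂ | z ∈ juliaAddress F s ∧ HasBoundedOrbit F z}.Subsingleton := by
  rintro z ⟨⟨hzJ, hzs⟩, hzb⟩ w ⟨⟨hwJ, hws⟩, hwb⟩
  have hH := hF.H_jordan.1
  obtain ⟨ε, hε, hεH⟩ := exists_uniform_nhd hF hd
  have hback : ∀ {x : ℂ}, x ∈ julia F 𝒯 → HasExternalAddress F x s → ∀ n,
      inverseBranch F (s n) (F^[n + 1] x) = F^[n] x := by
    intro x hxJ hxs n
    have h1 := hd (hxJ (n + 1))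
    rw [Function.iterate_succ_apply'] at h1 ⊢
    exact inverseBranch_map hF (s n).2 (hxs n) h1
  -- The orbit lies in the open tracts, not only in their closures, as `accumulate` requires.
  have hzT : ∀ n, F^[n] z ∈ (s n : Set ℂ) := fun n => by
    rw [← hback hzJ hzs n]
    exact inverseBranch_mapsTo hF (s n).2 (hd (hzJ _))
  have hTH : ∀ {T}, T ∈ tracts 𝒯 → T ⊆ H := fun hT =>
    (tract_subset hT).trans (subset_closure.trans hd)
  set D : ℕ → ℝ := fun n => caratheodory H (F^[n] z) (F^[n] w) with hD
  have hmono : Monotone D := monotone_nat_of_le_succ fun n => by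
    have := caratheodory_comp_le (inverseBranch_differentiableOn hF (s n).2)
      ((inverseBranch_mapsTo hF (s n).2).mono_right (hTH (s n).2)) (hd (hzJ (n + 1)))
      (hd (hwJ (n + 1)))
    rwa [hback hzJ hzs, hback hwJ hws] at this
  have hDb : BddAbove (Set.range D) := by
    refine ⟨2, ?_⟩
    rintro _ ⟨n, rfl⟩
    exact caratheodory_le fun f hf =>
      norm_sub_le_two_of_mem_unitHolo hf (hd (hzJ n)) (hd (hwJ n))
  have hDt : Tendsto D atTop (𝓝 (⨆ n, D n)) := tendsto_atTop_ciSup hmono hDb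
  set V : Ultrafilter ℕ := hyperfilter ℕ
  have hVle : (V : Filter ℕ) ≤ atTop := by
    rw [← Nat.cofinite_eq_atTop]; exact hyperfilter_le_cofinite
  have hlim : ∀ {x : ℂ}, x ∈ julia F 𝒯 → HasBoundedOrbit F x →
      ∃ y ∈ H, Tendsto (fun n => F^[n + 1] x) V (𝓝 y) := by
    intro x hxJ hxb
    have hcl : closure (Set.range fun n => F^[n] x) ⊆ H :=
      (closure_minimal (Set.range_subset_iff.2 hxJ) isClosed_closure).trans hd
    obtain ⟨y, hy, hle⟩ := hxb.isCompact_closure.ultrafilter_le_nhds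
      (V.map fun n => F^[n + 1] x) (by
        rw [le_principal_iff]
        exact mem_map.2 (univ_mem' fun n => subset_closure ⟨n + 1, rfl⟩))
    exact ⟨y, hcl hy, hle⟩
  obtain ⟨z', hz'H, hz'⟩ := hlim hzJ hzb
  obtain ⟨w', hw'H, hw'⟩ := hlim hwJ hwb
  obtain ⟨T, -, hVT⟩ : ∃ T ∈ Set.range s, ∀ᶠ n in (V : Filter ℕ), s n = T :=
    (Ultrafilter.eventually_exists_mem_iff (finite_range_of_boundedOrbit hF hzT hzb)).1
      (Eventually.of_forall fun n => ⟨s n, ⟨n, rfl⟩, rfl⟩)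
  have hbackt : ∀ {x y : ℂ}, x ∈ julia F 𝒯 → HasExternalAddress F x s → y ∈ H →
      Tendsto (fun n => F^[n + 1] x) V (𝓝 y) →
      Tendsto (fun n => F^[n] x) V (𝓝 (inverseBranch F T y)) := by
    intro x y hxJ hxs hy ht
    have hG : ContinuousAt (inverseBranch F T) y :=
      (inverseBranch_differentiableOn hF T.2).continuousOn.continuousAt (hH.mem_nhds hy)
    refine (hG.tendsto.comp ht).congr' ?_
    filter_upwards [hVT] with n hn
    rw [Function.comp_apply, ← hn, hback hxJ hxs]
  have hTmaps := inverseBranch_mapsTo hF T.2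
  have h1 : caratheodory H z' w' = ⨆ n, D n :=
    tendsto_nhds_unique (caratheodory_tendsto hH hz'H hw'H hz' hw')
      ((hDt.comp (tendsto_add_atTop_nat 1)).mono_left hVle)
  -- Pulling back shifts the index by one, which does not change the limit of `D`.
  have h2 : caratheodory H (inverseBranch F T z') (inverseBranch F T w') = ⨆ n, D n :=
    tendsto_nhds_unique (caratheodory_tendsto hH (hTH T.2 (hTmaps hz'H)) (hTH T.2 (hTmaps hw'H))
      (hbackt hzJ hzs hz'H hz') (hbackt hwJ hws hw'H hw')) (hDt.mono_left hVle)
  obtain ⟨a, r, hr, ha⟩ := exists_omitted_disc hF T.2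
  have hlimeq : z' = w' := by
    by_contra hne
    have := caratheodory_comp_lt hH hF.H_jordan.2.1.isPreconnected
      (inverseBranch_differentiableOn hF T.2) hTmaps (inverseBranch_injOn hF T.2) hr ha hε
      (fun y hy => hεH y (tract_subset T.2 hy)) hz'H hw'H hne
    rw [h1, h2] at this
    exact lt_irrefl _ this
  by_contra hne
  have hpos := caratheodory_pos (inverseBranch_differentiableOn hF T.2) hTmaps
    (inverseBranch_injOn hF T.2) hr ha (hd (hzJ 0)) (hd (hwJ 0)) hne
  have h0 : D 0 ≤ ⨆ n, D n := le_ciSup hDb 0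
  rw [← h1, hlimeq, caratheodory_self hw'H] at h0
  exact absurd hpos (not_lt.2 h0)
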